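/- For $x\in[0,1]$ put $I_0(x)=x^2$ and $I_1(x)=1-(1-x)^2$. For a binary string $b=b_1b_2\cdots b_n\in\{0,1\}^n$ ($n\ge 0$) put $I_b=I_{b_n}\circ\cdots\circ I_{b_2}\circ I_{b_1}$; for the empty string this is the identity. For binary strings $a,b$ write $a\succcurlyeq b$ if $I_a(x)\ge I_b(x)$ for all $x\in[0,1]$. For a binary string $a$, let $\pi(a)$ be the integer partition $p_1+p_2+\dots+p_m$, where $m$ is the number of ones in the string $1a0$ and $p_i$ is the number of zeros to the right of the $i$th one in $1a0$. For binary strings $u,v,b$, let $L_{0\to u,\,1\to v}(b)$ be the string obtained from $b$ by replacing each $0$ by $u$ and each $1$ by $v$. Theorem. Let $a$ and $b$ be binary strings of the same length and the same weight (number of ones), such that $\pi(a)$ dominates $\pi(b)$ in the dominance order of integer partitions: both are partitions of the same integer and, for every $k\ge 0$, the sum of the $k$ largest parts of $\pi(a)$ is at least the sum of the $k$ largest parts of $\pi(b)$. Then $$L_{0\to 01,\,1\to 10}(a)\succcurlyeq L_{0\to 01,\,1\to 10}(b)$$ and $$L_{0\to 100,\,1\to 011}(a)\succcurlyeq L_{0\to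 100,\,1\to 011}(b).$$ -/

import Mathlib

/-! Binary strings are lists of Booleans, `false` for the digit 0 and `true` for the digit 1. -/

namespace PolarBEC

/-- The one-step maps `I₀ x = x²` and `I₁ x = 1 - (1 - x)²`. -/
def step : Bool → ℝ → ℝ
  | false, x => x ^ 2
  | true, x => 1 - (1 - x) ^ 2

/-- `I_{b₁ b₂ … bₙ} x = I_{b₂ … bₙ} (I_{b₁} x)`: the capacity of the synthetic channel indexed by
a binary string, over the binary erasure channel of capacity `x`.
For the empty string it is `x`. -/
def capacity : List Bool → ℝ → ℝ
  | [], x => x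
  | c :: s, x => capacity s (step c x)

/-- The preorder `a ≽ b` on binary strings: `I_a x ≥ I_b x` for all `x ∈ [0, 1]`. -/
def Better (a b : List Bool) : Prop :=
  ∀ x ∈ Set.Icc (0 : ℝ) 1, capacity a x ≥ capacity b x

/-- The list, over the ones of a string from left to right, of the number of zeros to the right
of that one. -/
def zerosRight : List Bool → List ℕ
  | [] => []
  | true :: s => s.count false :: zerosRight s
  | false :: s => zerosRight s

theorem pos_of_mem_zerosRight_append (s : List Bool) :
    ∀ i ∈ zerosRight (s ++ [false]), 0 < i := by
  induction s with
  | nil => simp [zerosRight]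
  | cons c s ih =>
    cases c with
    | false => simpa [zerosRight] using ih
    | true =>
      intro i hi
      simp only [List.cons_append, zerosRight, List.mem_cons] at hi
      rcases hi with rfl | hi
      · simp
      · exact ih i hi

/-- The parts of `π(a)`: the number of zeros to the right of each one in the string `1a0`. -/
def partList (a : List Bool) : List ℕ :=
  zerosRight (true :: a ++ [false])

/-- The integer partition `π(a)`. -/
def partition (a : List Bool) : Nat.Partition (partList a).sum where
  parts := (partList a : Multiset ℕ)
  parts_pos := fun {i} hi =>
    pos_of_mem_zerosRight_append (true :: a) i (Multiset.mem_coe.mp hi)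
  parts_sum := Multiset.sum_coe _

/-- Dominance order of integer partitions: `p` and `q` partition the same integer and, for every
`k`, the sum of the `k` largest parts of `p` is at least the sum of the `k` largest parts of `q`
(parts beyond the last one count as zero). -/
def Dominates {m n : ℕ} (p : Nat.Partition m) (q : Nat.Partition n) : Prop :=
  m = n ∧ ∀ k : ℕ,
    ((q.parts.sort (· ≥ ·)).take k).sum ≤ ((p.parts.sort (· ≥ ·)).take k).sum

/-- The string obtained from `b` by replacing every `0` by the string `u` and every `1` by the
string `v`. -/
def lindenmayer (u v : List Bool) (b : List Bool) : List Bool :=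
  b.flatMap fun c => if c then v else u

end PolarBEC

/-! The proof has an analytic and a combinatorial half, which meet in one exchange: replacing `01 w
10` by `10 w 01` inside a string. Analysis: let `hi` and `lo` be the images of `10` and `01` under
the substitution. For odds `t = x / (1 - x)` and a suitable ratio `r = p / q ≥ 1`, `hi` multiplies
the odds by at least `r` relative to `lo`; no later step reduces a ratio of odds that is at least
`r` (`OddsAdvantage.step`); and a head start of `r` in the odds makes `lo` at least as good as `hi`.
Hence `hi w lo` beats `lo w hi` for every `w` (`better_exchange`). The first and last claims are
inequalities of polynomials in `t ≥ 0`, proved coefficientwise. Combinatorics: dominance amounts to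
comparing sums of prefix weights (`runsAhead_of_dominates`). If `a` is ahead of `b` in this sense,
exchanges in `b` align its first digit with that of `a` while keeping it behind `a`, and induction
on the tail finishes (`RunsAhead.rel`). -/

namespace PolarBEC

/-! ### Polynomials with natural coefficients as coefficient lists -/

/-- The value at `t` of the polynomial with the given list of coefficients. -/
def evalCoeffs : List ℕ → ℝ → ℝ
  | [], _ => 0
  | a :: p, t => a + t * evalCoeffs p t

/-- Sum of polynomials. -/
def addCoeffs : List ℕ → List ℕ → List ℕ
  | [], q => q
  | a :: p, [] => a :: p
  | a :: p, b :: q => (a + b) :: addCoeffs p q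

/-- Product of polynomials. -/
def mulCoeffs : List ℕ → List ℕ → List ℕ
  | [], _ => []
  | a :: p, q => addCoeffs (q.map (a * ·)) (0 :: mulCoeffs p q)

/-- Coefficientwise comparison of polynomials. -/
def leCoeffs : List ℕ → List ℕ → Bool
  | [], _ => true
  | a :: p, [] => a == 0 && leCoeffs p []
  | a :: p, b :: q => Nat.ble a b && leCoeffs p q

/-- The effect of a string on a fraction `n / d` of polynomials that stands for the odds
`x / (1 - x)` of a capacity `x`. -/
def oddsCoeffs : List Bool → List ℕ → List ℕ → List ℕ × List ℕ
  | [], n, d => (n, d)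
  | false :: s, n, d =>
    oddsCoeffs s (mulCoeffs n n) (mulCoeffs d (addCoeffs d (addCoeffs n n)))
  | true :: s, n, d =>
    oddsCoeffs s (mulCoeffs n (addCoeffs n (addCoeffs d d))) (mulCoeffs d d)

/-- The two coefficientwise inequalities between the odds of `hi` and `lo` that make an exchange
of `hi` and `lo` pay off by a factor `p / q`. -/
def exchangeCheck (hi lo : List Bool) (p q : ℕ) : Bool :=
  let h := oddsCoeffs hi [0, 1] [1]
  let l := oddsCoeffs lo [0, 1] [1]
  let l' := oddsCoeffs lo [0, p] [q]
  leCoeffs (mulCoeffs [p] (mulCoeffs l.1 h.2)) (mulCoeffs [q] (mulCoeffs h.1 l.2)) &&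
    leCoeffs (mulCoeffs h.1 l'.2) (mulCoeffs l'.1 h.2)

/-- As `t → 0` the odds of `1001` and `0110` behave like `32 t⁴` and `16 t⁴`, so the ratio must lie
between `2^(1/4)` and `2`; `5 / 4` does, and also works coefficientwise. -/
theorem exchangeCheck_two :
    exchangeCheck [true, false, false, true] [false, true, true, false] 5 4 = true := by
  decide +kernel

/-- Here the leading terms are `4096 t⁸` and `1024 t⁸`, which confine the ratio to the range from
`2^(1/4)` to `4`. -/
theorem exchangeCheck_three :
    exchangeCheck [false, true, true, true, false, false] [true, false, false, false, true, true]
      3 2 = true := by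
  decide +kernel

theorem evalCoeffs_nonneg (p : List ℕ) {t : ℝ} (ht : 0 ≤ t) : 0 ≤ evalCoeffs p t := by
  induction p with
  | nil => simp [evalCoeffs]
  | cons a p ih => simp only [evalCoeffs]; positivity

theorem evalCoeffs_add (p q : List ℕ) (t : ℝ) :
    evalCoeffs (addCoeffs p q) t = evalCoeffs p t + evalCoeffs q t := by
  induction p generalizing q with
  | nil => simp [addCoeffs, evalCoeffs]
  | cons a p ih =>
    cases q with
    | nil => simp [addCoeffs, evalCoeffs]
    | cons b q => simp only [addCoeffs, evalCoeffs, ih, Nat.cast_add]; ring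

theorem evalCoeffs_map_mul (a : ℕ) (q : List ℕ) (t : ℝ) :
    evalCoeffs (q.map (a * ·)) t = a * evalCoeffs q t := by
  induction q with
  | nil => simp [evalCoeffs]
  | cons b q ih => simp only [List.map_cons, evalCoeffs, ih, Nat.cast_mul]; ring

theorem evalCoeffs_mul (p q : List ℕ) (t : ℝ) :
    evalCoeffs (mulCoeffs p q) t = evalCoeffs p t * evalCoeffs q t := by
  induction p with
  | nil => simp [mulCoeffs, evalCoeffs]
  | cons a p ih =>
    simp only [mulCoeffs, evalCoeffs_add, evalCoeffs_map_mul, evalCoeffs, ih, Nat.cast_zero]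
    ring

theorem evalCoeffs_le_of_leCoeffs {p q : List ℕ} (h : leCoeffs p q = true) {t : ℝ}
    (ht : 0 ≤ t) : evalCoeffs p t ≤ evalCoeffs q t := by
  induction p generalizing q with
  | nil => simpa [evalCoeffs] using evalCoeffs_nonneg q ht
  | cons a p ih =>
    cases q with
    | nil =>
      simp only [leCoeffs, Bool.and_eq_true, beq_iff_eq] at h
      have := ih h.2
      simp only [evalCoeffs, h.1, Nat.cast_zero, zero_add] at this ⊢
      exact mul_nonpos_of_nonneg_of_nonpos ht this
    | cons b q =>
      simp only [leCoeffs, Bool.and_eq_true, Nat.ble_eq] at h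
      have h₁ : (a : ℝ) ≤ b := by exact_mod_cast h.1
      simp only [evalCoeffs]
      gcongr
      exact ih h.2

/-! ### Capacities -/

theorem step_mem_Icc (c : Bool) {x : ℝ} (hx : x ∈ Set.Icc (0 : ℝ) 1) :
    step c x ∈ Set.Icc (0 : ℝ) 1 := by
  obtain ⟨h₀, h₁⟩ := hx
  cases c <;> constructor <;> simp only [step] <;> nlinarith

theorem capacity_mem_Icc (s : List Bool) {x : ℝ} (hx : x ∈ Set.Icc (0 : ℝ) 1) :
    capacity s x ∈ Set.Icc (0 : ℝ) 1 := by
  induction s generalizing x with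
  | nil => exact hx
  | cons c s ih => exact ih (step_mem_Icc c hx)

theorem capacity_append (s u : List Bool) (x : ℝ) :
    capacity (s ++ u) x = capacity u (capacity s x) := by
  induction s generalizing x with
  | nil => rfl
  | cons c s ih => exact ih _

theorem capacity_one (s : List Bool) : capacity s 1 = 1 := by
  induction s with
  | nil => rfl
  | cons c s ih => cases c <;> simpa [capacity, step] using ih

theorem step_mono (c : Bool) {x y : ℝ} (hx : 0 ≤ x) (hy : y ≤ 1) (h : x ≤ y) :
    step c x ≤ step c y := by
  cases c <;> simp only [step] <;> nlinarith

theorem capacity_mono (s : List Bool) {x y : ℝ} (hx : x ∈ Set.Icc (0 : ℝ) 1)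
    (hy : y ∈ Set.Icc (0 : ℝ) 1) (h : x ≤ y) : capacity s x ≤ capacity s y := by
  induction s generalizing x y with
  | nil => exact h
  | cons c s ih =>
    exact ih (step_mem_Icc c hx) (step_mem_Icc c hy) (step_mono c hx.1 hy.2 h)

/-- On odds the two steps are `t ↦ t² / (1 + 2t)` and `t ↦ t² + 2t`. Each squares numerator plus
denominator, so positivity of that sum persists. -/
theorem oddsCoeffs_spec (s : List Bool) (n d : List ℕ) {t : ℝ}
    (hpos : 0 < evalCoeffs n t + evalCoeffs d t) :
    0 < evalCoeffs (oddsCoeffs s n d).1 t + evalCoeffs (oddsCoeffs s n d).2 t ∧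
      capacity s (evalCoeffs n t / (evalCoeffs n t + evalCoeffs d t)) =
        evalCoeffs (oddsCoeffs s n d).1 t /
          (evalCoeffs (oddsCoeffs s n d).1 t + evalCoeffs (oddsCoeffs s n d).2 t) := by
  induction s generalizing n d with
  | nil => exact ⟨hpos, rfl⟩
  | cons c s ih =>
    cases c
    · have key := ih (mulCoeffs n n) (mulCoeffs d (addCoeffs d (addCoeffs n n)))
      simp only [evalCoeffs_mul, evalCoeffs_add] at key
      have e : evalCoeffs n t * evalCoeffs n t + evalCoeffs d t * (evalCoeffs d t +
          (evalCoeffs n t + evalCoeffs n t)) = (evalCoeffs n t + evalCoeffs d t) ^ 2 := by ring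
      rw [e] at key
      have := key (by positivity)
      refine ⟨this.1, this.2 ▸ ?_⟩
      simp only [capacity, step]
      congr 1
      field_simp
    · have key := ih (mulCoeffs n (addCoeffs n (addCoeffs d d))) (mulCoeffs d d)
      simp only [evalCoeffs_mul, evalCoeffs_add] at key
      have e : evalCoeffs n t * (evalCoeffs n t + (evalCoeffs d t + evalCoeffs d t)) +
          evalCoeffs d t * evalCoeffs d t = (evalCoeffs n t + evalCoeffs d t) ^ 2 := by ring
      rw [e] at key
      have := key (by positivity)
      refine ⟨this.1, this.2 ▸ ?_⟩
      simp only [capacity, step]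
      congr 1
      field_simp
      ring

/-! ### Comparison of odds -/

/-- The odds `y / (1 - y)` are at least `p / q` times the odds `x / (1 - x)`. -/
def OddsAdvantage (p q : ℕ) (x y : ℝ) : Prop :=
  p * (x * (1 - y)) ≤ q * (y * (1 - x))

theorem OddsAdvantage.le {p q : ℕ} (hq : 0 < q) (hpq : q ≤ p) {x y : ℝ}
    (hx : x ∈ Set.Icc (0 : ℝ) 1) (hy : y ∈ Set.Icc (0 : ℝ) 1) (h : OddsAdvantage p q x y) :
    x ≤ y := by
  have hq' : (0 : ℝ) < q := by exact_mod_cast hq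
  have hpq' : (q : ℝ) ≤ p := by exact_mod_cast hpq
  have h₁ : (q : ℝ) * (x * (1 - y)) ≤ q * (y * (1 - x)) :=
    (mul_le_mul_of_nonneg_right hpq' (mul_nonneg hx.1 (by linarith [hy.2]))).trans h
  have h₂ := le_of_mul_le_mul_left h₁ hq'
  linarith

/-- A step multiplies the odds ratio by `y(1+x) / (x(1+y))` or `(2-y)(1-x) / ((2-x)(1-y))`; both are
at least 1 because `x ≤ y`. -/
theorem OddsAdvantage.step {p q : ℕ} (hq : 0 < q) (hpq : q ≤ p) (c : Bool) {x y : ℝ}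
    (hx : x ∈ Set.Icc (0 : ℝ) 1) (hy : y ∈ Set.Icc (0 : ℝ) 1) (h : OddsAdvantage p q x y) :
    OddsAdvantage p q (step c x) (step c y) := by
  have hxy := h.le hq hpq hx hy
  obtain ⟨hx₀, hx₁⟩ := hx
  obtain ⟨hy₀, hy₁⟩ := hy
  unfold OddsAdvantage at h ⊢
  cases c
  · simp only [PolarBEC.step]
    calc (p : ℝ) * (x ^ 2 * (1 - y ^ 2)) = p * (x * (1 - y)) * (x * (1 + y)) := by ring
      _ ≤ q * (y * (1 - x)) * (y * (1 + x)) := by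
        apply mul_le_mul h (by nlinarith) (by positivity)
        have : 0 ≤ 1 - x := by linarith
        positivity
      _ = _ := by ring
  · simp only [PolarBEC.step]
    have h₁ : 0 ≤ 1 - x := by linarith
    have h₂ : 0 ≤ 1 - y := by linarith
    calc (p : ℝ) * ((1 - (1 - x) ^ 2) * (1 - (1 - (1 - y) ^ 2)))
        = p * (x * (1 - y)) * ((2 - x) * (1 - y)) := by ring
      _ ≤ q * (y * (1 - x)) * ((2 - y) * (1 - x)) := by
        apply mul_le_mul h (by nlinarith) (mul_nonneg (by linarith) h₂)
        positivity
      _ = _ := by ring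

theorem OddsAdvantage.capacity {p q : ℕ} (hq : 0 < q) (hpq : q ≤ p) (s : List Bool) {x y : ℝ}
    (hx : x ∈ Set.Icc (0 : ℝ) 1) (hy : y ∈ Set.Icc (0 : ℝ) 1) (h : OddsAdvantage p q x y) :
    OddsAdvantage p q (capacity s x) (capacity s y) := by
  induction s generalizing x y with
  | nil => exact h
  | cons c s ih => exact ih (step_mem_Icc c hx) (step_mem_Icc c hy) (h.step hq hpq c hx hy)

theorem oddsAdvantage_capacity_of_exchangeCheck {hi lo : List Bool} {p q : ℕ}
    (hcheck : exchangeCheck hi lo p q = true) {x : ℝ} (hx : x ∈ Set.Icc (0 : ℝ) 1) :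
    OddsAdvantage p q (capacity lo x) (capacity hi x) := by
  -- At `x = 1` the odds are infinite, but every capacity is 1.
  rcases hx.2.eq_or_lt with rfl | hx₁
  · simp [OddsAdvantage, capacity_one]
  have hx' : 0 < 1 - x := by linarith
  set t := x / (1 - x) with ht
  have ht₀ : 0 ≤ t := div_nonneg hx.1 hx'.le
  have hpos : 0 < evalCoeffs [0, 1] t + evalCoeffs [1] t := by
    simp only [evalCoeffs]; norm_num; positivity
  have hxt : x = evalCoeffs [0, 1] t / (evalCoeffs [0, 1] t + evalCoeffs [1] t) := by
    rw [eq_div_iff hpos.ne', ht]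
    simp only [evalCoeffs]
    push_cast
    field_simp
    ring
  obtain ⟨hh₀, hh⟩ := oddsCoeffs_spec hi _ _ hpos
  obtain ⟨hl₀, hl⟩ := oddsCoeffs_spec lo _ _ hpos
  rw [← hxt] at hh hl
  simp only [exchangeCheck, Bool.and_eq_true] at hcheck
  have key := evalCoeffs_le_of_leCoeffs hcheck.1 ht₀
  simp only [evalCoeffs_mul] at key
  simp only [evalCoeffs, mul_zero, add_zero] at key
  rw [hh, hl, OddsAdvantage, one_sub_div hh₀.ne', one_sub_div hl₀.ne', div_mul_div_comm,
    div_mul_div_comm, add_sub_cancel_left, add_sub_cancel_left, ← mul_div_assoc,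
    ← mul_div_assoc, mul_comm (_ + _) (_ + _)]
  gcongr

theorem OddsAdvantage.capacity_le_of_exchangeCheck {hi lo : List Bool} {p q : ℕ} (hq : 0 < q)
    (hpq : q ≤ p) (hcheck : exchangeCheck hi lo p q = true) {x y : ℝ}
    (hx : x ∈ Set.Icc (0 : ℝ) 1) (hy : y ∈ Set.Icc (0 : ℝ) 1) (h : OddsAdvantage p q x y) :
    PolarBEC.capacity hi x ≤ PolarBEC.capacity lo y := by
  have hq' : (0 : ℝ) < q := by exact_mod_cast hq
  rcases hx.2.eq_or_lt with rfl | hx₁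
  · have : y = 1 := by
      simp only [OddsAdvantage, sub_self, mul_zero, one_mul] at h
      have hp' : (0 : ℝ) < p := hq'.trans_le (by exact_mod_cast hpq)
      linarith [hy.2, nonpos_of_mul_nonpos_right h hp']
    rw [this, capacity_one, capacity_one]
  have hx' : 0 < 1 - x := by linarith
  set t := x / (1 - x) with ht
  have ht₀ : 0 ≤ t := div_nonneg hx.1 hx'.le
  have hpos : 0 < evalCoeffs [0, 1] t + evalCoeffs [1] t := by
    simp only [evalCoeffs]; norm_num; positivity
  have hxt : x = evalCoeffs [0, 1] t / (evalCoeffs [0, 1] t + evalCoeffs [1] t) := by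
    rw [eq_div_iff hpos.ne', ht]
    simp only [evalCoeffs]
    push_cast
    field_simp
    ring
  have hpos' : 0 < evalCoeffs [0, p] t + evalCoeffs [q] t := by
    simp only [evalCoeffs]; norm_num; positivity
  have hyt : evalCoeffs [0, p] t / (evalCoeffs [0, p] t + evalCoeffs [q] t) ≤ y := by
    rw [div_le_iff₀ hpos']
    simp only [evalCoeffs, ht, OddsAdvantage] at h ⊢
    have := div_le_div_of_nonneg_right h hx'.le
    have e₁ : (p : ℝ) * (x * (1 - y)) / (1 - x) = p * (x / (1 - x)) * (1 - y) := by ring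
    have e₂ : (q : ℝ) * (y * (1 - x)) / (1 - x) = q * y := by field_simp
    rw [e₁, e₂] at this
    push_cast
    linarith
  obtain ⟨hh₀, hh⟩ := oddsCoeffs_spec hi _ _ hpos
  obtain ⟨hl₀, hl⟩ := oddsCoeffs_spec lo _ _ hpos'
  rw [← hxt] at hh
  -- By monotonicity of `lo`, `y` may be lowered until its odds are exactly `p / q` times those of
  -- `x`.
  refine le_trans ?_ (capacity_mono lo ⟨?_, hyt.trans hy.2⟩ hy hyt)
  · simp only [exchangeCheck, Bool.and_eq_true] at hcheck
    have key := evalCoeffs_le_of_leCoeffs hcheck.2 ht₀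
    simp only [evalCoeffs_mul] at key
    rw [hh, hl, div_le_div_iff₀ hh₀ hl₀]
    linarith
  · exact div_nonneg (evalCoeffs_nonneg _ ht₀) hpos'.le

theorem better_exchange {hi lo : List Bool} {p q : ℕ} (hq : 0 < q) (hpq : q ≤ p)
    (hcheck : exchangeCheck hi lo p q = true) (w v : List Bool) :
    Better (hi ++ (w ++ (lo ++ v))) (lo ++ (w ++ (hi ++ v))) := by
  intro x hx
  simp only [capacity_append]
  have hlo := capacity_mem_Icc lo hx
  have hhi := capacity_mem_Icc hi hx
  have h := (oddsAdvantage_capacity_of_exchangeCheck hcheck hx).capacity hq hpq w hlo hhi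
  have hlo' := capacity_mem_Icc w hlo
  have hhi' := capacity_mem_Icc w hhi
  exact capacity_mono v (capacity_mem_Icc _ hlo') (capacity_mem_Icc _ hhi')
    (h.capacity_le_of_exchangeCheck hq hpq hcheck hlo' hhi')

theorem Better.append_left {a b : List Bool} (h : Better a b) (u : List Bool) :
    Better (u ++ a) (u ++ b) := by
  intro x hx
  rw [capacity_append, capacity_append]
  exact h _ (capacity_mem_Icc u hx)

theorem Better.refl (a : List Bool) : Better a a := fun _ _ => le_rfl

theorem Better.trans {a b c : List Bool} (hab : Better a b) (hbc : Better b c) : Better a c :=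
  fun x hx => (hbc x hx).trans (hab x hx)

/-! ### From the dominance order to exchanges -/

/-- `a` runs ahead of `b` when it starts `d` ones ahead: the running sum, which starts at `S`, of
the lead of `a` over `b` in ones read so far stays nonnegative, and the lead and its running sum
end at zero. -/
def RunsAhead : ℤ → ℤ → List Bool → List Bool → Prop
  | d, S, [], [] => d = 0 ∧ S = 0
  | d, S, x :: a, y :: b =>
    0 ≤ S + (d + x.toNat - y.toNat) ∧
      RunsAhead (d + x.toNat - y.toNat) (S + (d + x.toNat - y.toNat)) a b
  | _, _, _, _ => False

theorem RunsAhead.cons {d S d' S' : ℤ} {x y : Bool} {a b : List Bool}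
    (h : RunsAhead d' S' a b) (hS : 0 ≤ S') (hd' : d' = d + x.toNat - y.toNat)
    (hS' : S' = S + d') : RunsAhead d S (x :: a) (y :: b) := by
  subst hS' hd'
  exact ⟨hS, h⟩

theorem RunsAhead.exists_cons {d S : ℤ} {y : Bool} {a b : List Bool}
    (h : RunsAhead d S a (y :: b)) : ∃ x a', a = x :: a' ∧
      0 ≤ S + (d + x.toNat - y.toNat) ∧
      RunsAhead (d + x.toNat - y.toNat) (S + (d + x.toNat - y.toNat)) a' b := by
  cases a with
  | nil => exact h.elim
  | cons x a => exact ⟨x, a, rfl, h⟩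

theorem toNat_mem (x : Bool) : (0 : ℤ) ≤ x.toNat ∧ (x.toNat : ℤ) ≤ 1 := by
  cases x <;> simp

/-- Reading a one with a positive running sum, the next descent of `b` can be reversed. -/
theorem RunsAhead.lower_after_one {b : List Bool} {d S : ℤ} {a : List Bool}
    (h : RunsAhead d S a (true :: b)) (hS : 1 ≤ S) :
    ∃ u v, true :: b = u ++ true :: false :: v ∧
      RunsAhead d (S - 1) a (u ++ false :: true :: v) := by
  induction b generalizing d S a with
  | nil =>
    obtain ⟨x, a, rfl, h₀, h⟩ := h.exists_cons
    cases a with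
    | nil =>
      obtain ⟨h₁, h₂⟩ := h
      omega
    | cons => exact h.elim
  | cons y b ih =>
    obtain ⟨x, a, rfl, h₀, h⟩ := h.exists_cons
    have hx := toNat_mem x
    cases y with
    | false =>
      obtain ⟨x', a, rfl, h₀', h⟩ := h.exists_cons
      simp only [Bool.toNat_true, Bool.toNat_false, Nat.cast_one, Nat.cast_zero] at h h₀ h₀'
      refine ⟨[], b, rfl, ?_⟩
      refine RunsAhead.cons (RunsAhead.cons h h₀' ?_ rfl) (d' := d + x.toNat)
        (S' := S + (d + x.toNat - 1)) h₀ ?_ ?_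
      · simp only [Bool.toNat_true, Nat.cast_one]; ring
      · simp only [Bool.toNat_false, Nat.cast_zero]; ring
      · ring
    | true =>
      by_cases hpos : 1 ≤ S + (d + x.toNat - Bool.toNat true)
      · obtain ⟨u, v, huv, h'⟩ := ih h hpos
        refine ⟨true :: u, v, by simp [huv], ?_⟩
        exact RunsAhead.cons h' (by omega) rfl (by ring)
      -- The sum has just dropped from positive to 0, so the lead is negative; another one in `b`
      -- keeps it negative and would make the sum negative.
      · obtain ⟨x', a, rfl, h₀', h⟩ := h.exists_cons
        have := toNat_mem x'
        simp only [Bool.toNat_true, Nat.cast_one] at *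
        omega

/-- While `a` is ahead of `b` with a positive running sum, some descent of `b` can be
reversed. -/
theorem RunsAhead.lower {b : List Bool} {d S : ℤ} {a : List Bool} (h : RunsAhead d S a b)
    (hd : 0 ≤ d) (hS : 1 ≤ S) :
    ∃ u v, b = u ++ true :: false :: v ∧ RunsAhead d (S - 1) a (u ++ false :: true :: v) := by
  induction b generalizing d S a with
  | nil =>
    cases a with
    | nil => have := h.2; omega
    | cons => exact h.elim
  | cons y b ih =>
    cases y with
    | true => exact h.lower_after_one hS
    | false =>
      obtain ⟨x, a, rfl, h₀, h⟩ := h.exists_cons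
      have hx := toNat_mem x
      simp only [Bool.toNat_false, Nat.cast_zero] at h h₀
      obtain ⟨u, v, rfl, h'⟩ := ih h (by omega) (by omega)
      exact ⟨false :: u, v, rfl, RunsAhead.cons h' (by omega) (by simp) (by ring)⟩

/-- If `a` gets ahead of `b = 01…` in the first digit, then an exchange brings `b` to a string with
leading digit 1 that is still behind `a`. -/
theorem RunsAhead.exists_exchange {d S : ℤ} {a b : List Bool} {x : Bool}
    (h : RunsAhead d S (x :: a) (false :: true :: b)) (hS : 0 ≤ S) (hd : 1 ≤ d + x.toNat) :
    ∃ w v, b = w ++ true :: false :: v ∧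
      RunsAhead d S (x :: a) (true :: false :: (w ++ false :: true :: v)) := by
  obtain ⟨_, _, he, h₀, h⟩ := h.exists_cons
  obtain ⟨rfl, rfl⟩ := List.cons.inj he
  obtain ⟨y, a, rfl, h₀', h⟩ := h.exists_cons
  have hy := toNat_mem y
  simp only [Bool.toNat_true, Bool.toNat_false, Nat.cast_one, Nat.cast_zero, sub_zero]
    at h h₀ h₀'
  -- Turning the leading `01` into `10` lowers the running sum by 1 until a reversed descent
  -- restores it. After two digits the lead is nonnegative and the sum positive, so such a descent
  -- exists.
  obtain ⟨w, v, rfl, h'⟩ := h.lower (by omega) (by omega)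
  refine ⟨w, v, rfl, ?_⟩
  exact RunsAhead.cons (RunsAhead.cons h' (by omega) (d := d + x.toNat - 1)
    (S := S + (d + x.toNat) - 1) (by simp; ring) (by ring)) (by omega) (by simp) (by ring)

/-- If `a` gets ahead of `b` in the first digit, then a relation that allows exchanges improves
`b` to a string with leading digit 1 that is still behind `a`. -/
theorem RunsAhead.exists_lead_one {R : List Bool → List Bool → Prop}
    (htrans : ∀ {a b c}, R a b → R b c → R a c)
    (hcons : ∀ {a b} (c : Bool), R a b → R (c :: a) (c :: b))
    (hexchange : ∀ w v, R (true :: false :: (w ++ false :: true :: v))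
      (false :: true :: (w ++ true :: false :: v)))
    {b : List Bool} {d S : ℤ} {a : List Bool} {x : Bool}
    (h : RunsAhead d S (x :: a) (false :: b)) (hS : 0 ≤ S) (hd : 1 ≤ d + x.toNat) :
    ∃ c, R (true :: c) (false :: b) ∧ RunsAhead d S (x :: a) (true :: c) := by
  induction b generalizing d S a x with
  | nil =>
    cases a with
    | nil =>
      have := h.2.1
      simp only [Bool.toNat_false, Nat.cast_zero] at this
      omega
    | cons => exact h.2.elim
  | cons y b ih =>
    cases y with
    | true =>
      obtain ⟨w, v, rfl, h'⟩ := h.exists_exchange hS hd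
      exact ⟨_, hexchange w v, h'⟩
    | false =>
      obtain ⟨h₀, h⟩ := h
      obtain ⟨y, a, rfl, -⟩ := h.exists_cons
      have hy := toNat_mem y
      simp only [Bool.toNat_false, Nat.cast_zero, sub_zero] at h h₀
      -- The lead is still at least 1 after the first digit, so the tail can first be given a
      -- leading 1, which reduces to the case `01…`.
      obtain ⟨c, hR, h'⟩ := ih h h₀ (by omega)
      have h'' : RunsAhead d S (x :: y :: a) (false :: true :: c) :=
        RunsAhead.cons h' h₀ (by simp) rfl
      obtain ⟨w, v, rfl, h₃⟩ := h''.exists_exchange hS hd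
      exact ⟨_, htrans (hexchange w v) (hcons false hR), h₃⟩

/-- A preorder on strings that is stable under prepending digits and that favours exchanges
relates every string to those behind it. -/
theorem RunsAhead.rel {R : List Bool → List Bool → Prop} (hrefl : ∀ a, R a a)
    (htrans : ∀ {a b c}, R a b → R b c → R a c)
    (hcons : ∀ {a b} (c : Bool), R a b → R (c :: a) (c :: b))
    (hexchange : ∀ w v, R (true :: false :: (w ++ false :: true :: v))
      (false :: true :: (w ++ true :: false :: v)))
    {a b : List Bool} (h : RunsAhead 0 0 a b) : R a b := by
  induction a generalizing b with
  | nil =>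
    cases b with
    | nil => exact hrefl []
    | cons => exact h.elim
  | cons x a ih =>
    cases b with
    | nil => exact h.elim
    | cons y b =>
      have same : ∀ {x : Bool} {b : List Bool}, RunsAhead 0 0 (x :: a) (x :: b) →
          R (x :: a) (x :: b) := by
        intro x b h
        have := h.2
        simp only [zero_add, sub_self] at this
        exact hcons x (ih this)
      cases x <;> cases y
      · exact same h
      · simpa using h.1
      · obtain ⟨c, hR, h'⟩ := h.exists_lead_one (R := R) htrans hcons hexchange le_rfl (by simp)
        exact htrans (same h') hR
      · exact same h

/-! ### Dominance as comparison of cumulative weights -/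

/-- The sum over the ones of a string of the length of the suffix that starts there, which is the
sum over its nonempty prefixes of their weights. -/
def cumulativeWeight : List Bool → ℕ
  | [] => 0
  | true :: s => s.length + 1 + cumulativeWeight s
  | false :: s => cumulativeWeight s

theorem cumulativeWeight_cons (c : Bool) (s : List Bool) :
    cumulativeWeight (c :: s) = c.toNat * (s.length + 1) + cumulativeWeight s := by
  cases c <;> simp [cumulativeWeight]

theorem runsAhead_of_cumulativeWeight {a b : List Bool} {d S : ℤ}
    (hlength : a.length = b.length)
    (hweight : d + a.count true = b.count true)
    (hle : ∀ t ≤ a.length,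
      (cumulativeWeight (b.take t) : ℤ) ≤ S + t * d + cumulativeWeight (a.take t))
    (heq : (cumulativeWeight b : ℤ) = S + a.length * d + cumulativeWeight a) :
    RunsAhead d S a b := by
  induction a generalizing b d S with
  | nil =>
    cases b with
    | nil =>
      simp only [List.count_nil, List.length_nil, cumulativeWeight] at hweight heq
      exact ⟨by simpa using hweight, by simpa using heq.symm⟩
    | cons => simp at hlength
  | cons x a ih =>
    cases b with
    | nil => simp at hlength
    | cons y b =>
      simp only [List.length_cons, add_left_inj] at hlength
      have hcount : ∀ (c : Bool) (s : List Bool),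
          (c :: s).count true = c.toNat + s.count true := by
        intro c s
        cases c <;> simp [add_comm]
      have key : ∀ t ≤ a.length, (cumulativeWeight (b.take t) : ℤ) ≤
          S + (d + x.toNat - y.toNat) + t * (d + x.toNat - y.toNat) +
            cumulativeWeight (a.take t) := by
        intro t ht
        have := hle (t + 1) (by simpa using ht)
        simp only [List.take_succ_cons, cumulativeWeight_cons, List.length_take,
          min_eq_left ht, min_eq_left (hlength ▸ ht)] at this
        push_cast at this
        linarith
      refine ⟨by simpa [cumulativeWeight] using key 0 (Nat.zero_le _), ih hlength ?_ key ?_⟩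
      · rw [hcount, hcount] at hweight
        push_cast at hweight
        linarith
      · simp only [cumulativeWeight_cons, List.length_cons, hlength] at heq ⊢
        push_cast at heq
        linarith

theorem le_count_of_mem_zerosRight {s : List Bool} {i : ℕ} (hi : i ∈ zerosRight s) :
    i ≤ s.count false := by
  induction s with
  | nil => simp [zerosRight] at hi
  | cons c s ih =>
    cases c with
    | false =>
      have := ih hi
      simp only [List.count_cons_self]
      omega
    | true =>
      rcases List.mem_cons.mp hi with rfl | hi
      · simp
      · simpa using ih hi

theorem pairwise_zerosRight (s : List Bool) : (zerosRight s).Pairwise (· ≥ ·) := by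
  induction s with
  | nil => exact List.Pairwise.nil
  | cons c s ih =>
    cases c with
    | false => exact ih
    | true => exact List.Pairwise.cons (fun _ h => le_count_of_mem_zerosRight h) ih

theorem length_zerosRight (s : List Bool) : (zerosRight s).length = s.count true := by
  induction s with
  | nil => rfl
  | cons c s ih => cases c <;> simp [zerosRight, ih]

theorem sort_partition (a : List Bool) :
    (partition a).parts.sort (· ≥ ·) = partList a := by
  simp only [partition, Multiset.coe_sort]
  exact List.mergeSort_eq_self _ (by
    simpa only [decide_eq_true_eq] using! pairwise_zerosRight (true :: a ++ [false]))

/-- The sum of the first `k` entries of `zerosRight` bounds the cumulative weight of any prefix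
from below. -/
theorem sum_take_zerosRight_le (u v : List Bool) (k : ℕ) :
    2 * (((zerosRight (u ++ v)).take k).sum : ℤ)
        + 2 * k * (u.length - (u ++ v).count false) - k * (k - 1) ≤
      2 * cumulativeWeight u := by
  induction u generalizing k with
  | nil =>
    have h : ((zerosRight v).take k).sum ≤ k * v.count false := by
      calc ((zerosRight v).take k).sum
          ≤ ((zerosRight v).take k).length • v.count false :=
            List.sum_le_card_nsmul _ _ fun i hi =>
              le_count_of_mem_zerosRight (List.mem_of_mem_take hi)
        _ ≤ k * v.count false := Nat.mul_le_mul_right _ (List.length_take_le _ _)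
    have h' : (((zerosRight v).take k).sum : ℤ) ≤ k * v.count false := by exact_mod_cast h
    have hk : (0 : ℤ) ≤ k * (k - 1) := by
      cases k with
      | zero => simp
      | succ k => push_cast; nlinarith
    simp only [List.nil_append, List.length_nil, cumulativeWeight, Nat.cast_zero]
    linarith
  | cons c u ih =>
    cases c with
    | false =>
      have := ih k
      simp only [List.cons_append, zerosRight, List.length_cons, List.count_cons_self,
        cumulativeWeight]
      simp only [Nat.cast_add, Nat.cast_one]
      linarith
    | true =>
      cases k with
      | zero => simp
      | succ k =>
        have := ih k
        simp only [List.cons_append, zerosRight, List.length_cons, List.take_succ_cons,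
          List.sum_cons, cumulativeWeight]
        rw [List.count_cons_of_ne (by simp)]
        simp only [Nat.cast_add, Nat.cast_one]
        linarith

/-- The bound of `sum_take_zerosRight_le` is attained for the number of ones of the prefix. -/
theorem sum_take_count_zerosRight (u v : List Bool) :
    2 * (((zerosRight (u ++ v)).take (u.count true)).sum : ℤ)
        + 2 * (u.count true) * (u.length - (u ++ v).count false)
        - u.count true * (u.count true - 1) =
      2 * cumulativeWeight u := by
  induction u with
  | nil => simp [cumulativeWeight]
  | cons c u ih =>
    cases c with
    | false =>
      simp only [List.cons_append, zerosRight, List.length_cons, List.count_cons_self,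
        cumulativeWeight]
      rw [List.count_cons_of_ne (by simp)]
      simp only [Nat.cast_add, Nat.cast_one]
      linarith
    | true =>
      simp only [List.cons_append, zerosRight, List.length_cons, List.count_cons_self,
        List.take_succ_cons, List.sum_cons, cumulativeWeight]
      rw [List.count_cons_of_ne (by simp)]
      simp only [Nat.cast_add, Nat.cast_one]
      linarith

/-- A discrete Legendre duality. With `z` zeros in all, if the `i`th one is at position `j` and has
`pᵢ` zeros to its right, then `pᵢ = z - (j - i)`, so its suffix in the prefix of length `t` has
length `t - j + 1 = pᵢ + t - z - (i - 1)`. These terms decrease in `i` and are positive exactly for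
`j ≤ t`, so the cumulative weight is the maximum over `k` of their partial sums. It suffices to use
the optimal `k` for `b`. -/
theorem cumulativeWeight_take_le_of_sum_take_zerosRight_le {a b : List Bool}
    (hlength : a.length = b.length) (hweight : a.count true = b.count true)
    (h : ∀ k, ((zerosRight b).take k).sum ≤ ((zerosRight a).take k).sum) (t : ℕ) :
    cumulativeWeight (b.take t) ≤ cumulativeWeight (a.take t) := by
  have hzeros : a.count false = b.count false := by
    have ha := List.count_false_add_count_true a
    have hb := List.count_false_add_count_true b
    omega
  have h₁ := sum_take_count_zerosRight (b.take t) (b.drop t)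
  have h₂ := sum_take_zerosRight_le (a.take t) (a.drop t) ((b.take t).count true)
  have h₃ : (_ : ℤ) ≤ _ := Nat.cast_le.mpr (h ((b.take t).count true))
  rw [List.take_append_drop, List.length_take] at h₁ h₂
  rw [hlength, hzeros] at h₂
  have : (cumulativeWeight (b.take t) : ℤ) ≤ cumulativeWeight (a.take t) := by linarith
  exact_mod_cast this

theorem cumulativeWeight_eq_of_sum_zerosRight_eq {a b : List Bool}
    (hlength : a.length = b.length) (hweight : a.count true = b.count true)
    (h : (zerosRight a).sum = (zerosRight b).sum) :
    cumulativeWeight a = cumulativeWeight b := by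
  have key : ∀ s : List Bool, 2 * ((zerosRight s).sum : ℤ)
      + 2 * (s.count true) * (s.length - s.count false) - s.count true * (s.count true - 1) =
      2 * cumulativeWeight s := by
    intro s
    have := sum_take_count_zerosRight s []
    rwa [List.append_nil, ← length_zerosRight, List.take_length, length_zerosRight] at this
  have hzeros : a.count false = b.count false := by
    have ha := List.count_false_add_count_true a
    have hb := List.count_false_add_count_true b
    omega
  have ha := key a
  have hb := key b
  rw [h, hweight, hlength, hzeros, hb] at ha
  omega

theorem cumulativeWeight_append_singleton_false (s : List Bool) :
    cumulativeWeight (s ++ [false]) = cumulativeWeight s + s.count true := by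
  induction s with
  | nil => rfl
  | cons c s ih =>
    rw [List.cons_append, cumulativeWeight_cons, cumulativeWeight_cons, ih]
    cases c
    · simp
    · simp only [List.length_append, List.length_singleton, List.count_cons_self, Bool.toNat_true]
      ring

theorem runsAhead_of_dominates {a b : List Bool} (hlength : a.length = b.length)
    (hweight : a.count true = b.count true)
    (hdom : Dominates (partition a) (partition b)) : RunsAhead 0 0 a b := by
  obtain ⟨hsum, hle⟩ := hdom
  simp only [sort_partition] at hle
  have hl : (true :: a ++ [false]).length = (true :: b ++ [false]).length := by simp [hlength]
  have hw : (true :: a ++ [false]).count true = (true :: b ++ [false]).count true := by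
    simp [hweight]
  refine runsAhead_of_cumulativeWeight hlength (by simp [hweight]) ?_ ?_
  · intro t ht
    -- The prefix of length `t + 1` of `1a0` is a 1 followed by `t` digits of `a`; the extra 1 adds
    -- `t + 1` on both sides.
    have := cumulativeWeight_take_le_of_sum_take_zerosRight_le hl hw hle (t + 1)
    simp only [List.cons_append, List.take_succ_cons, cumulativeWeight, List.length_take,
      hlength, List.take_append_of_le_length ht,
      List.take_append_of_le_length (hlength ▸ ht)] at this
    simp only [mul_zero, zero_add, Nat.cast_le]
    omega
  · have := cumulativeWeight_eq_of_sum_zerosRight_eq hl hw hsum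
    rw [cumulativeWeight_append_singleton_false, cumulativeWeight_append_singleton_false,
      cumulativeWeight, cumulativeWeight] at this
    simp only [List.count_cons_self, hlength, hweight] at this
    simp only [mul_zero, zero_add, Nat.cast_inj]
    omega

/-! ### Substitution turns exchanges of digits into exchanges of blocks -/

theorem lindenmayer_cons (u v : List Bool) (c : Bool) (s : List Bool) :
    lindenmayer u v (c :: s) = (if c then v else u) ++ lindenmayer u v s := rfl

theorem lindenmayer_append (u v s s' : List Bool) :
    lindenmayer u v (s ++ s') = lindenmayer u v s ++ lindenmayer u v s' :=
  List.flatMap_append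

/-- If exchanging `v ++ u` and `u ++ v` pays off, then the substitution `0 → u`, `1 → v` turns the
dominance order into the order of capacities. -/
theorem better_lindenmayer_of_dominates {u v : List Bool} {p q : ℕ} (hq : 0 < q) (hpq : q ≤ p)
    (hcheck : exchangeCheck (v ++ u) (u ++ v) p q = true) {a b : List Bool}
    (hlength : a.length = b.length) (hweight : a.count true = b.count true)
    (hdom : Dominates (partition a) (partition b)) :
    Better (lindenmayer u v a) (lindenmayer u v b) := by
  refine (runsAhead_of_dominates hlength hweight hdom).rel
    (R := fun a b => Better (lindenmayer u v a) (lindenmayer u v b))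
    (fun _ => Better.refl _) Better.trans (fun c h => h.append_left _) fun w s => ?_
  simpa [lindenmayer_cons, lindenmayer_append] using
    better_exchange hq hpq hcheck (lindenmayer u v w) (lindenmayer u v s)

end PolarBEC

theorem mainTheorem5 (a b : List Bool)
    (hlength : a.length = b.length)
    (hweight : a.count true = b.count true)
    (hdom : PolarBEC.Dominates (PolarBEC.partition a) (PolarBEC.partition b)) :
    PolarBEC.Better
      (PolarBEC.lindenmayer [false, true] [true, false] a)
      (PolarBEC.lindenmayer [false, true] [true, false] b) ∧
    PolarBEC.Better
      (PolarBEC.lindenmayer [true, false, false] [false, true, true] a)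
      (PolarBEC.lindenmayer [true, false, false] [false, true, true] b) := by
  exact ⟨PolarBEC.better_lindenmayer_of_dominates (by norm_num) (by norm_num)
      PolarBEC.exchangeCheck_two hlength hweight hdom,
    PolarBEC.better_lindenmayer_of_dominates (by norm_num) (by norm_num)
      PolarBEC.exchangeCheck_three hlength hweight hdom⟩
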